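/- A partition of a positive integer $k$ is a finite multiset $\lambda=\{k_1,\dots,k_q\}$ of positive integers with $k_1+\dots+k_q=k$. A $\lambda$-assignment of a finite simple graph $G$ assigns to each vertex $v$ a set $L(v)$ of $k$ colours so that $\bigcup_{v} L(v)$ can be partitioned into sets $C_1,\dots,C_q$ with $|L(v)\cap C_i|=k_i$ for every vertex $v$ and every $i$. The graph $G$ is $\lambda$-choosable if for every $\lambda$-assignment $L$ it has a proper colouring $f$ with $f(v)\in L(v)$ for all $v$. For a partition $\lambda=\{k_1,\dots,k_q\}$ of $k$ and a partition $\lambda'$ of $k'$, write $\lambda\le\lambda'$ if there is a partition $\lambda''=\{k_1'',\dots,k_q''\}$ of $k'$ with $k_i''\ge k_i$ for all $i$ such that $\lambda'$ is a refinement of $\lambda''$, that is, $\lambda'$ arises from $\lambda''$ by replacing parts by partitions of these parts. The girth of a graph is the smallest length of its cycles ($\infty$ if there are none). **Theorem.** Let $\lambda$ be a partition of a positive integer $k$ and let $\lambda_1,\dots,\lambda_p$ be partitions of positive integers with $\lambda\not\le\lambda_i$ for every $i=1,\dots,p$. Then for every positive integer $g$ there is a finite graph $G$ of girth at least $g$ that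 is $\lambda$-choosable but, for every $i=1,\dots,p$, not $\lambda_i$-choosable. If moreover $g\ge 3$, and either $k\ge 3$ or $k=2$ and $g$ is even, then $G$ can be chosen to have girth exactly $g$. -/

import Mathlib

/-- `μ` is a refinement of `ν`: it is obtained from `ν` by replacing each part of `ν` by a
partition of that part. The multiset `P` lists the replacing partitions, one for each part
(a part that is left alone is replaced by the one-part partition of itself). -/
def Nat.Partition.IsRefinement {k : ℕ} (μ ν : Nat.Partition k) : Prop :=
  ∃ P : Multiset (Multiset ℕ), P.map Multiset.sum = ν.parts ∧ P.join = μ.parts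

/-- The relation `l ≤ l'` between a partition `l` of `k` and a partition `l'` of `k'`: there is a
partition `ν` of `k'` obtained by (weakly) increasing the parts of `l`, such that `l'` is a
refinement of `ν`. (This forces `k ≤ k'`.) -/
def Nat.Partition.Dominated {k k' : ℕ} (l : Nat.Partition k) (l' : Nat.Partition k') : Prop :=
  ∃ ν : Nat.Partition k', Multiset.Rel (fun a b : ℕ => a ≤ b) l.parts ν.parts ∧ l'.IsRefinement ν

namespace SimpleGraph

/-- `L` is an `l`-assignment, where `l = {κ 0, …, κ (q - 1)}` is a partition of `k`: all lists have
`k` colours, and the set of all colours used in the lists is partitioned into colour groups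
`D 0, …, D (q - 1)` such that every list has exactly `κ i` colours in `D i`. -/
def IsPartitionAssignment {V C : Type} {k : ℕ} (l : Nat.Partition k) (L : V → Finset C) : Prop :=
  (∀ v, (L v).card = k) ∧
    ∃ (q : ℕ) (κ : Fin q → ℕ) (D : Fin q → Set C),
      Multiset.map κ Finset.univ.val = l.parts ∧
      (∀ i j, i ≠ j → Disjoint (D i) (D j)) ∧
      (⋃ i, D i) = (⋃ v, (L v : Set C)) ∧
      ∀ v i, ((L v : Set C) ∩ D i).ncard = κ i

/-- `G` has a proper colouring that takes the colour of each vertex `v` from the list `L v`. -/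
def ListColorable {V C : Type} (G : SimpleGraph V) (L : V → Finset C) : Prop :=
  ∃ f : G.Coloring C, ∀ v, f v ∈ L v

/-- `G` is `l`-choosable: it is `L`-colourable for every `l`-assignment `L`, whatever the
colours are. -/
def PartitionChoosable {V : Type} (G : SimpleGraph V) {k : ℕ} (l : Nat.Partition k) : Prop :=
  ∀ (C : Type) (L : V → Finset C), IsPartitionAssignment l L → G.ListColorable L

end SimpleGraph

/-!
The graph is a disjoint union of one graph for each `l' i`, plus a cycle of length `g` when the girth
has to be exact. A cycle of length `g` is `l`-choosable if `3 ≤ k` (degeneracy) or if `k = 2` and `g`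
is even (`cycleGraph_listColorable_of_even`). So it remains to separate `l = {κ 0, …, κ (q - 1)}`
from one partition `l' = {κ' 0, …, κ' (t - 1)}` of `m` by a graph of large girth.

*Without the girth condition.* `l` is not dominated by `l'` exactly if for every map
`φ : Fin t → Fin q` there is an `i` with `∑ j with φ j = i, κ' j < κ i`
(`Nat.Partition.dominated_of_le_sum` gives the direction that is used). Take `t` colour groups of `2 * m`
colours, and all lists with `κ' j` colours in group `j` for every `j`. In `joinOfCliques κ κ' m`,
class `i` consists of a clique of size `κ i` for every list, all vertices of that clique having this
list, and different classes are completely joined. The classes use disjoint sets of colours, so each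
colour group is largely used by at most one class; this defines `φ`, and class `i` for the above `i`
cannot be coloured (`joinOfCliques_not_colorable`). On the other hand, every graph whose vertices fall
into `q` classes such that class `i` is `(κ i - 1)`-degenerate is `l`-choosable, since class `i` can
be coloured greedily with the colours of the `i`-th group
(`SimpleGraph.HasDegenerateClasses.partitionChoosable`).

*Making the graph sparse.* `exists_sparse_lift` replaces a finite graph `H` with ordered vertices by a
graph over `H` of large girth in which each vertex has at most one neighbour in each later fibre, and
every colouring of which induces a colouring of `H` that uses, at a vertex, a colour of its fibre.
The former property preserves the degeneracy of the classes, the latter the impossibility of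
colouring from the lists. The lift is built by adding the vertices of `H` one by one, as in the
construction of Blanche Descartes, from hypergraphs without short cycles in which every colouring has
a monochromatic hyperedge. These come from the partite amalgamation of Nešetřil and Rödl
(`exists_bergeSparse_hasMonoEdge`).

*Counting instead of cycles.* The absence of cycles of length less than `g` is expressed by
`BergeSparse g`: any `t` hyperedges with `0 < t < g` cover at least `1 + ∑ (|e| - 1)` points. A
cycle violates this, and the inequality behaves well under amalgamation (`BergeSparse.glue`), which
is the step behind both the hypergraphs and the lift.
-/

open Finset

/-! ### Hypergraphs without short cycles and their amalgamation -/

open Classical in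
/-- A family `e : J → ι → Z` of `ι`-tuples, viewed as a hypergraph with hyperedges `range (e j)`, has
no short cycles: any `t` hyperedges with `0 < t < g` cover at least `t * (|ι| - 1) + 1` points (a
hypergraph cycle of length `t` covers at most `t * (|ι| - 1)`). For `2 ≤ g` the tuples are
injective. -/
def BergeSparse {J ι Z : Type} [Fintype ι] (g : ℕ) (e : J → ι → Z) : Prop :=
  ∀ T : Finset J, T.Nonempty → #T < g →
    #T * Fintype.card ι + 1 ≤ #(T.biUnion fun j => univ.image (e j)) + #T

section
variable {J ι Z X JF : Type} [Fintype ι] {g : ℕ}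

theorem bergeSparse_iff [DecidableEq Z] {e : J → ι → Z} : BergeSparse g e ↔
    ∀ T : Finset J, T.Nonempty → #T < g →
      #T * Fintype.card ι + 1 ≤ #(T.biUnion fun j => univ.image (e j)) + #T := by
  unfold BergeSparse
  congr!

theorem BergeSparse.le_card [DecidableEq Z] {e : J → ι → Z} (h : BergeSparse g e)
    {T : Finset J} (hT : T.Nonempty) (hc : #T < g) :
    #T * Fintype.card ι + 1 ≤ #(T.biUnion fun j => univ.image (e j)) + #T :=
  bergeSparse_iff.1 h T hT hc

/-- The defining inequality passes to hyperedges from which some points are dropped. -/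
theorem BergeSparse.sum_card_le [DecidableEq ι] [DecidableEq Z] {e : J → ι → Z}
    (h : BergeSparse g e) {T : Finset J} (hT : T.Nonempty) (hc : #T < g) (B : J → Finset ι) :
    ∑ j ∈ T, #(B j) + 1 ≤ #(T.biUnion fun j => (B j).image (e j)) + #T := by
  have h1 := h.le_card hT hc
  have h2 : (T.biUnion fun j => univ.image (e j)) ⊆
      (T.biUnion fun j => (B j).image (e j)) ∪ T.biUnion fun j => (B j)ᶜ.image (e j) := by
    intro z hz
    simp only [mem_biUnion, mem_image, mem_univ, true_and, mem_union, mem_compl] at hz ⊢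
    obtain ⟨j, hj, i, rfl⟩ := hz
    by_cases hi : i ∈ B j
    · exact Or.inl ⟨j, hj, i, hi, rfl⟩
    · exact Or.inr ⟨j, hj, i, hi, rfl⟩
  have h3 := (card_le_card h2).trans (card_union_le _ _)
  have h4 : #(T.biUnion fun j => (B j)ᶜ.image (e j)) ≤ ∑ j ∈ T, #(B j)ᶜ :=
    card_biUnion_le.trans (sum_le_sum fun j _ => card_image_le)
  have h5 : ∑ j ∈ T, #(B j) + ∑ j ∈ T, #(B j)ᶜ = #T * Fintype.card ι := by
    rw [← sum_add_distrib, sum_congr rfl fun j _ => card_add_card_compl (B j)]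
    simp
  omega

/-- The copy, with label `f`, of a set `Z` in an amalgam of many copies of `Z`: the points of `Z`
satisfying `p` are placed in `X` by `a`, the other points are private to the copy. -/
def glue (p : Z → Prop) [DecidablePred p] (a : {z // p z} → X) (f : JF) (z : Z) :
    X ⊕ (JF × {z // ¬ p z}) :=
  if h : p z then Sum.inl (a ⟨z, h⟩) else Sum.inr (f, ⟨z, h⟩)

/-- Gluing copies of a sparse hypergraph along the hyperedges of a sparse hypergraph gives a sparse
hypergraph. As a hyperedge has at most one point in the glued part, only copies that contribute at
least two hyperedges matter, whence the gain from `g` to `g + 1`. -/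
theorem BergeSparse.glue [Fintype Z] [DecidableEq Z] [DecidableEq J]
    {p : Z → Prop} [DecidablePred p] [Fintype {z // p z}]
    {e : J → ι → Z} {eF : JF → {z // p z} → X} (hg : 2 ≤ g) (he : BergeSparse (g + 1) e)
    (hp : ∀ j i i', p (e j i) → p (e j i') → i = i') (hF : BergeSparse g eF) :
    BergeSparse (g + 1) fun (fj : JF × J) i => glue p (eF fj.1) fj.1 (e fj.2 i) := by
  classical
  refine bergeSparse_iff.2 fun T hT hc => ?_
  -- the hyperedges of `T` in copy `f`, and the points of `Z` they cover
  let TT : JF → Finset J := fun f => (T.filter fun x => x.1 = f).image Prod.snd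
  let U : JF → Finset Z := fun f => (TT f).biUnion fun j => univ.image (e j)
  let A : JF → Finset {z // ¬ p z} := fun f => (U f).subtype fun z => ¬ p z
  let B : JF → Finset {z // p z} := fun f => (U f).subtype p
  let F := T.image Prod.fst
  have hTT : ∀ f j, j ∈ TT f ↔ (f, j) ∈ T := by
    intro f j; simp [TT]
  have hcardTT : ∀ f, #(TT f) = #(T.filter fun x => x.1 = f) := by
    intro f
    refine card_image_of_injOn ?_
    rintro ⟨a, b⟩ h1 ⟨a', b'⟩ h2 h3
    simp at h1 h2 h3
    simp [h1.2, h2.2, h3]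
  have hsumT : ∑ f ∈ F, #(TT f) = #T := by
    simp_rw [hcardTT]
    exact (card_eq_sum_card_image Prod.fst T).symm
  have hAB : ∀ f, #(U f) = #(A f) + #(B f) := by
    intro f
    rw [card_subtype, card_subtype, add_comm]
    exact (card_filter_add_card_filter_not (s := U f) p).symm
  have hne : ∀ f ∈ F, (TT f).Nonempty := by
    intro f hf
    obtain ⟨⟨f', j⟩, hx, rfl⟩ := mem_image.1 hf
    exact ⟨j, (hTT _ _).2 hx⟩
  have hleT : ∀ f, #(TT f) ≤ #T := fun f => (hcardTT f).trans_le (card_filter_le _ _)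
  have hU : ∀ f ∈ F, #(TT f) * Fintype.card ι + 1 ≤ #(A f) + #(B f) + #(TT f) := by
    intro f hf
    rw [← hAB]
    exact he.le_card (hne f hf) ((hleT f).trans_lt hc)
  have hU1 : ∀ f ∈ F, #(TT f) < 2 → #(TT f) * Fintype.card ι ≤ #(A f) + #(TT f) := by
    intro f hf hlt
    have h1 := hU f hf
    have h2 : #(B f) ≤ 1 := by
      rw [card_le_one]
      rintro ⟨z, hz⟩ h3 ⟨z', hz'⟩ h4
      simp only [B, U, mem_subtype, mem_biUnion, mem_image, mem_univ, true_and] at h3 h4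
      obtain ⟨j, hj, i, rfl⟩ := h3
      obtain ⟨j', hj', i', rfl⟩ := h4
      obtain rfl : j = j' := card_le_one.1 (by omega : #(TT f) ≤ 1) j hj j' hj'
      obtain rfl := hp j i i' hz hz'
      rfl
    omega
  -- a nonempty set of fewer than `g` copies outside of which there is one hyperedge per copy
  obtain ⟨K, hKF, hKne, hKc, hK⟩ : ∃ K ⊆ F, K.Nonempty ∧ #K < g ∧ ∀ f ∈ F \ K, #(TT f) < 2 := by
    by_cases h2 : (F.filter fun f => 2 ≤ #(TT f)).Nonempty
    · refine ⟨_, filter_subset _ _, h2, ?_, ?_⟩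
      · have h3 : #(F.filter fun f => 2 ≤ #(TT f)) * 2 ≤
            ∑ f ∈ F.filter (fun f => 2 ≤ #(TT f)), #(TT f) := by
          rw [← smul_eq_mul]
          exact card_nsmul_le_sum _ _ _ fun f hf => (mem_filter.1 hf).2
        have h4 : ∑ f ∈ F.filter (fun f => 2 ≤ #(TT f)), #(TT f) ≤ ∑ f ∈ F, #(TT f) :=
          sum_le_sum_of_subset (filter_subset _ _)
        omega
      · intro f hf
        simp only [mem_sdiff, mem_filter, not_and, not_le] at hf
        exact hf.2 hf.1
    · obtain ⟨x, hx⟩ := hT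
      refine ⟨{x.1}, ?_, singleton_nonempty _, by simpa using by omega, ?_⟩
      · simpa [F] using ⟨x.2, hx⟩
      · intro f hf
        by_contra h3
        exact h2 ⟨f, mem_filter.2 ⟨(mem_sdiff.1 hf).1, by omega⟩⟩
  -- add up `hU` over the copies in `K` and `hU1` over the others: private points are counted copy by
  -- copy, points in the glued part by the sparsity of the hypergraph `eF`
  have hX := hF.sum_card_le hKne hKc B
  set O := T.biUnion fun fj => univ.image fun i => _root_.glue p (eF fj.1) fj.1 (e fj.2 i) with hO
  have hmemU : ∀ f z, z ∈ U f → _root_.glue p (eF f) f z ∈ O := by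
    intro f z hz
    simp only [U, mem_biUnion, mem_image, mem_univ, true_and, hTT] at hz
    obtain ⟨j, hj, i, rfl⟩ := hz
    simp only [hO, mem_biUnion, mem_image, mem_univ, true_and]
    exact ⟨(f, j), hj, i, rfl⟩
  have hL : #(K.biUnion fun f => (B f).image (eF f)) ≤ #O.toLeft := by
    refine card_le_card fun x hx => ?_
    simp only [mem_biUnion, mem_image] at hx
    obtain ⟨f, hf, ⟨z, hz⟩, hzB, rfl⟩ := hx
    have := hmemU f z (mem_subtype.1 hzB)
    rw [_root_.glue, dif_pos hz] at this
    exact mem_toLeft.2 this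
  have hR : ∑ f ∈ F, #(A f) ≤ #O.toRight := by
    rw [← card_sigma]
    refine card_le_card_of_injOn (fun x => (x.1, x.2)) ?_ ?_
    · rintro ⟨f, ⟨z, hz⟩⟩ hx
      have hx := (mem_sigma.1 hx).2
      have := hmemU f z (mem_subtype.1 hx)
      rw [_root_.glue, dif_neg hz] at this
      exact mem_toRight.2 this
    · rintro ⟨f, z⟩ _ ⟨f', z'⟩ _ h
      simp only [Prod.mk.injEq] at h
      obtain ⟨rfl, rfl⟩ := h
      rfl
  have hLR := card_toLeft_add_card_toRight (u := O)
  have hs1 : ∑ f ∈ F \ K, #(TT f) * Fintype.card ι ≤ ∑ f ∈ F \ K, (#(A f) + #(TT f)) :=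
    sum_le_sum fun f hf => hU1 f (mem_sdiff.1 hf).1 (hK f hf)
  have hs2 : ∑ f ∈ K, (#(TT f) * Fintype.card ι + 1) ≤ ∑ f ∈ K, (#(A f) + #(B f) + #(TT f)) :=
    sum_le_sum fun f hf => hU f (hKF hf)
  simp only [sum_add_distrib, sum_const, smul_eq_mul, mul_one, ← sum_mul] at hs1 hs2
  have e1 := sum_sdiff hKF (f := fun f => #(TT f))
  have e2 := sum_sdiff hKF (f := fun f => #(A f))
  have e3 : (∑ f ∈ F \ K, #(TT f)) * Fintype.card ι + (∑ f ∈ K, #(TT f)) * Fintype.card ι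
      = #T * Fintype.card ι := by rw [← add_mul, e1, hsumT]
  omega

end

/-! ### Sparse hypergraphs with a monochromatic hyperedge in every colouring -/

section
variable {J ι Z X JF A C : Type} [Fintype ι] {g : ℕ}

theorem glue_of_pos {p : Z → Prop} [DecidablePred p] (a : {z // p z} → X) (f : JF) {z : Z}
    (h : p z) : glue p a f z = Sum.inl (a ⟨z, h⟩) := dif_pos h

theorem glue_of_neg {p : Z → Prop} [DecidablePred p] (a : {z // p z} → X) (f : JF) {z : Z}
    (h : ¬ p z) : glue p a f z = Sum.inr (f, ⟨z, h⟩) := dif_neg h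

theorem bergeSparse_two {e : J → ι → Z} (he : ∀ j, Function.Injective (e j)) :
    BergeSparse 2 e := by
  classical
  intro T hT hc
  obtain ⟨j, rfl⟩ := card_eq_one.1 (by have := hT.card_pos; omega : #T = 1)
  simp [card_image_of_injective _ (he j)]

theorem bergeSparse_disjoint (g : ℕ) : BergeSparse g fun (j : J) (i : ι) => (j, i) := by
  classical
  refine bergeSparse_iff.2 fun T hT _ => ?_
  rw [card_biUnion]
  · simp only [card_image_of_injective _ (Prod.mk_right_injective _), card_univ, sum_const,
      smul_eq_mul]
    have := hT.card_pos
    omega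
  · intro j _ j' _ hj
    refine disjoint_left.2 fun x hx hx' => hj ?_
    simp only [mem_image, mem_univ, true_and] at hx hx'
    obtain ⟨i, rfl⟩ := hx
    obtain ⟨i', h⟩ := hx'
    exact (congrArg Prod.fst h).symm

/-- Every colouring of the points with colours in `C` has a monochromatic hyperedge. -/
def HasMonoEdge (C : Type) (e : J → ι → X) : Prop :=
  ∀ c : X → C, ∃ j γ, ∀ i, c (e j i) = γ

/-- One run of the partite amalgamation: the parts are the points of a hypergraph `e₀` with
`HasMonoEdge C e₀`, and the parts in `S` have been amalgamated along hypergraphs in which every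
colouring has a monochromatic hyperedge, so that only colourings constant on the remaining parts
have to be considered. -/
theorem exists_partite [Nonempty C] (hg : 2 ≤ g)
    (hF : ∀ (κ : Type) [Fintype κ], ∃ (X J : Type) (_ : Finite X) (_ : Finite J) (e : J → κ → X),
      BergeSparse g e ∧ HasMonoEdge C e)
    {J₀ : Type} [Finite J₀] {e₀ : J₀ → ι → A} (hinj : ∀ j, Function.Injective (e₀ j))
    (hmono : HasMonoEdge C e₀) (S : Finset A) :
    ∃ (Z J : Type) (_ : Finite Z) (_ : Finite J) (e : J → ι → Z) (π : Z → A),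
      (∀ j, Function.Injective (π ∘ e j)) ∧ BergeSparse (g + 1) e ∧
      ∀ c : Z → C, (∀ z z', π z = π z' → π z ∉ S → c z = c z') → ∃ j γ, ∀ i, c (e j i) = γ := by
  classical
  induction S using Finset.induction_on with
  | empty =>
    refine ⟨J₀ × ι, J₀, inferInstance, inferInstance, fun j i => (j, i), fun z => e₀ z.1 z.2,
      hinj, bergeSparse_disjoint _, fun c hc => ?_⟩
    obtain ⟨j, γ, h⟩ := hmono fun a =>
      if h : ∃ z : J₀ × ι, e₀ z.1 z.2 = a then c h.choose else Classical.arbitrary C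
    refine ⟨j, γ, fun i => ?_⟩
    have hex : ∃ z : J₀ × ι, e₀ z.1 z.2 = e₀ j i := ⟨(j, i), rfl⟩
    rw [← h i, dif_pos hex]
    exact hc _ _ hex.choose_spec.symm (by simp)
  | insert a S ha ih =>
    obtain ⟨Z, J, _, _, e, π, hπ, hsp, hcol⟩ := ih
    have := Fintype.ofFinite Z
    obtain ⟨X, JF, _, _, eF, hFsp, hFmono⟩ := hF {z // π z = a}
    have hπglue : ∀ f z, Sum.elim (fun _ => a) (fun y => π y.2)
        (glue (fun z => π z = a) (eF f) f z) = π z := by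
      intro f z
      by_cases h : π z = a
      · rw [glue_of_pos (p := fun z => π z = a) _ _ h]; exact h.symm
      · rw [glue_of_neg (p := fun z => π z = a) _ _ h]; rfl
    refine ⟨X ⊕ (JF × {z // ¬ π z = a}), JF × J, inferInstance, inferInstance, _,
      Sum.elim (fun _ => a) (fun y => π y.2), ?_, BergeSparse.glue hg hsp ?_ hFsp, ?_⟩
    · rintro ⟨f, j⟩ i i' h
      simp only [Function.comp_apply, hπglue] at h
      exact hπ j h
    · intro j i i' h h'
      exact hπ j (h.trans h'.symm)
    · intro c hc
      obtain ⟨f, γ, hf⟩ := hFmono (c ∘ Sum.inl)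
      have hconst : ∀ z z', π z = π z' → π z ∉ S →
          c (glue (fun z => π z = a) (eF f) f z) = c (glue (fun z => π z = a) (eF f) f z') := by
        intro z z' hzz hz
        by_cases h : π z = a
        · rw [glue_of_pos (p := fun z => π z = a) _ _ h,
            glue_of_pos (p := fun z => π z = a) _ _ (hzz ▸ h)]
          exact (hf _).trans (hf _).symm
        · refine hc _ _ (by rw [hπglue, hπglue, hzz]) ?_
          rw [hπglue]
          simp [h, hz]
      obtain ⟨j, γ', hj⟩ := hcol _ hconst
      exact ⟨(f, j), γ', hj⟩

/-- Hypergraphs of any uniformity without short cycles in which every colouring by a given finite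
set of colours has a monochromatic hyperedge. -/
theorem exists_bergeSparse_hasMonoEdge (C : Type) [Finite C] [Nonempty C] (g : ℕ) (hg : 2 ≤ g)
    (ι : Type) [Fintype ι] : ∃ (X J : Type) (_ : Finite X) (_ : Finite J) (e : J → ι → X),
      BergeSparse g e ∧ HasMonoEdge C e := by
  classical
  have := Fintype.ofFinite C
  have base : ∀ (κ : Type) [Fintype κ], HasMonoEdge C fun (j : κ ↪ C × κ) (i : κ) => j i := by
    intro κ _ c
    obtain ⟨γ, hγ⟩ := Fintype.exists_le_card_fiber_of_mul_le_card (n := Fintype.card κ) c (by simp)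
    have hle : Fintype.card κ ≤ Fintype.card {x // c x = γ} := by
      rwa [Fintype.card_subtype]
    obtain ⟨φ⟩ := Function.Embedding.nonempty_of_card_le hle
    exact ⟨φ.trans (Function.Embedding.subtype _), γ, fun i => (φ i).2⟩
  induction g, hg using Nat.le_induction generalizing ι with
  | base => exact ⟨C × ι, ι ↪ C × ι, inferInstance, inferInstance, _,
      bergeSparse_two fun j => j.injective, base ι⟩
  | succ g hg ih =>
    obtain ⟨Z, J, hZ, hJ, e, π, -, hsp, hcol⟩ :=
      exists_partite hg ih (fun j => j.injective) (base ι) univ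
    exact ⟨Z, J, hZ, hJ, e, hsp, fun c => hcol c fun z z' _ h => absurd (mem_univ _) h⟩

end

/-! ### Sparse lifts of graphs -/

section
variable {J Z K C : Type} {g : ℕ}

/-- The `2`-uniform family obtained from `e` by attaching a pendant edge at each of the points
`w k`; the value `none` provides one further isolated point. -/
def addPendants (e : J → Fin 2 → Z) (w : K → Z) : J ⊕ K → Fin 2 → Z ⊕ Option K :=
  Sum.elim (fun j i => Sum.inl (e j i)) fun k => ![Sum.inl (w k), Sum.inr (some k)]

theorem BergeSparse.addPendants {e : J → Fin 2 → Z} (he : BergeSparse g e) (w : K → Z) :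
    BergeSparse g (addPendants e w) := by
  classical
  refine bergeSparse_iff.2 fun T hT hc => ?_
  set O := T.biUnion fun j => univ.image (_root_.addPendants e w j) with hO
  have hT' := card_toLeft_add_card_toRight (u := T)
  have hO' := card_toLeft_add_card_toRight (u := O)
  have hmem : ∀ j ∈ T, ∀ i, _root_.addPendants e w j i ∈ O := fun j hj i =>
    mem_biUnion.2 ⟨j, hj, mem_image_of_mem _ (mem_univ i)⟩
  have hR : #T.toRight ≤ #O.toRight := by
    refine card_le_card_of_injOn some (fun k hk => ?_) (Option.some_injective _).injOn
    exact mem_toRight.2 (hmem _ (mem_toRight.1 hk) 1)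
  have hL : #T.toLeft + 1 ≤ #O.toLeft := by
    rcases T.toLeft.eq_empty_or_nonempty with h | h
    · have h2 : T.toRight.Nonempty := by
        rw [← card_pos]
        have := hT.card_pos
        rw [h, card_empty] at hT'
        omega
      obtain ⟨k, hk⟩ := h2
      have : (w k) ∈ O.toLeft := mem_toLeft.2 (hmem _ (mem_toRight.1 hk) 0)
      rw [h, card_empty]
      exact card_pos.2 ⟨_, this⟩
    · have h1 := he.le_card h (by omega)
      have h2 : #(T.toLeft.biUnion fun j => univ.image (e j)) ≤ #O.toLeft := by
        refine card_le_card fun z hz => ?_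
        simp only [mem_biUnion, mem_image, mem_univ, true_and] at hz
        obtain ⟨j, hj, i, rfl⟩ := hz
        exact mem_toLeft.2 (hmem _ (mem_toLeft.1 hj) i)
      rw [Fintype.card_fin] at h1
      omega
  rw [Fintype.card_fin]
  omega

/-- Sparse lifting of a graph `H` with ordered vertices, here of its subgraph induced by `S`. The
lift is a graph without short cycles over `H`, given by the family `e` of its edges, in which every
vertex has at most one neighbour in each later fibre, and every proper colouring of which induces a
proper colouring of `H` that picks, at each vertex `h`, a colour used in the fibre of `h`.

The vertex `h` that comes last is added as follows: take many copies of the lift built so far, give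
each vertex over a neighbour of `h` a pendant edge, and amalgamate the new end vertices along a
hypergraph with a monochromatic hyperedge in every colouring. The copy at that hyperedge sees just
one colour over `h`. -/
theorem exists_sparse_lift {VH : Type} [LinearOrder VH] (H : SimpleGraph VH) (C : Type) [Finite C]
    [Nonempty C] (g : ℕ) (hg : 2 ≤ g) (S : Finset VH) :
    ∃ (Z J : Type) (_ : Finite Z) (_ : Finite J) (e : J → Fin 2 → Z) (π : Z → VH),
      (∀ z, π z ∈ S) ∧
      (∀ j, H.Adj (π (e j 0)) (π (e j 1)) ∧ π (e j 0) < π (e j 1)) ∧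
      (∀ j j', e j 0 = e j' 0 → π (e j 1) = π (e j' 1) → e j 1 = e j' 1) ∧
      BergeSparse (g + 1) e ∧
      ∀ c : Z → C, (∀ j, c (e j 0) ≠ c (e j 1)) → ∃ s : VH → C,
        (∀ h ∈ S, ∃ z, π z = h ∧ c z = s h) ∧ ∀ h ∈ S, ∀ h' ∈ S, H.Adj h h' → s h ≠ s h' := by
  classical
  induction S using Finset.induction_on_max with
  | empty =>
    refine ⟨Empty, Empty, inferInstance, inferInstance, fun j => j.elim, fun z => z.elim,
      fun z => z.elim, fun j => j.elim, fun j => j.elim, ?_, fun c _ =>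
        ⟨fun _ => Classical.arbitrary C, by simp⟩⟩
    rintro T ⟨j, -⟩
    exact j.elim
  | insert h S hS ih =>
    obtain ⟨Z, J, _, _, e, π, hπS, hadj, huniq, hsp, hcol⟩ := ih
    have := Fintype.ofFinite Z
    have hhS : h ∉ S := fun hh => lt_irrefl h (hS h hh)
    let K := {z : Z // H.Adj (π z) h}
    -- the isolated point `none` makes sure that the fibre of `h` is nonempty in the amalgam
    let e₁ : J ⊕ K → Fin 2 → Z ⊕ Option K := addPendants e Subtype.val
    let p : Z ⊕ Option K → Prop := fun z => z.isRight
    obtain ⟨X, JF, _, _, eF, hFsp, hFmono⟩ :=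
      exists_bergeSparse_hasMonoEdge C g hg {z : Z ⊕ Option K // p z}
    let π' : X ⊕ (JF × {z // ¬ p z}) → VH :=
      Sum.elim (fun _ => h) fun y => Sum.elim π (fun _ => h) y.2.1
    let cp : JF → Z → X ⊕ (JF × {z // ¬ p z}) := fun f z => Sum.inr (f, ⟨Sum.inl z, by simp [p]⟩)
    let pt : JF → Option K → X ⊕ (JF × {z // ¬ p z}) := fun f k =>
      Sum.inl (eF f ⟨Sum.inr k, by simp [p]⟩)
    have hgl : ∀ f z, glue p (eF f) f (Sum.inl z) = cp f z := fun f z => glue_of_neg _ _ _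
    have hgr : ∀ f k, glue p (eF f) f (Sum.inr k) = pt f k := fun f k =>
      glue_of_pos _ _ (by simp [p])
    let e' : JF × (J ⊕ K) → Fin 2 → X ⊕ (JF × {z // ¬ p z}) := fun fj i =>
      glue p (eF fj.1) fj.1 (e₁ fj.2 i)
    have hl : ∀ f j i, e' (f, Sum.inl j) i = cp f (e j i) := fun f j i => hgl _ _
    have hr0 : ∀ f k, e' (f, Sum.inr k) 0 = cp f k.1 := fun f k => hgl _ _
    have hr1 : ∀ f k, e' (f, Sum.inr k) 1 = pt f (some k) := fun f k => hgr _ _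
    have hπcp : ∀ f z, π' (cp f z) = π z := fun _ _ => rfl
    have hπpt : ∀ f k, π' (pt f k) = h := fun _ _ => rfl
    have hcp : ∀ f z f' z', cp f z = cp f' z' → f = f' ∧ z = z' := by
      intro f z f' z' hh
      simpa [cp] using hh
    refine ⟨X ⊕ (JF × {z // ¬ p z}), JF × (J ⊕ K), inferInstance, inferInstance, e', π',
      ?_, ?_, ?_, ?_, ?_⟩
    · rintro (x | ⟨f, ⟨z | k, hz⟩⟩)
      · exact mem_insert_self _ _
      · exact mem_insert_of_mem (hπS z)
      · exact mem_insert_self _ _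
    · rintro ⟨f, j | k⟩
      · rw [hl, hl, hπcp, hπcp]
        exact hadj j
      · rw [hr0, hr1, hπcp, hπpt]
        exact ⟨k.2, hS _ (hπS _)⟩
    · rintro ⟨f, j | k⟩ ⟨f', j' | k'⟩ h0 h1
      · rw [hl, hl] at h0 h1 ⊢
        obtain ⟨rfl, hz⟩ := hcp _ _ _ _ h0
        rw [huniq j j' hz h1]
      · rw [hl, hr1, hπcp, hπpt] at h1
        exact absurd (h1 ▸ hπS _) hhS
      · rw [hl, hr1, hπcp, hπpt] at h1
        exact absurd (h1 ▸ hπS _) hhS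
      · rw [hr0, hr0] at h0
        obtain ⟨rfl, hz⟩ := hcp _ _ _ _ h0
        rw [Subtype.ext hz]
    · refine BergeSparse.glue hg (hsp.addPendants _) ?_ hFsp
      have hone : ∀ j i, p (e₁ j i) → i = 1 := by
        rintro (j | k) i hi
        · exact absurd hi (by simp [p, e₁, addPendants])
        · by_contra h1
          obtain rfl : i = 0 := by omega
          exact absurd hi (by simp [p, e₁, addPendants])
      exact fun j i i' hi hi' => (hone j i hi).trans (hone j i' hi').symm
    · intro c hc
      obtain ⟨f, γ, hf⟩ := hFmono (c ∘ Sum.inl)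
      have hfγ : ∀ k, c (pt f k) = γ := fun k => hf _
      obtain ⟨s, hs, hsadj⟩ := hcol (fun z => c (cp f z)) fun j => by
        have := hc (f, Sum.inl j)
        rwa [hl, hl] at this
      have key : ∀ a ∈ S, H.Adj a h → s a ≠ γ := by
        intro a ha hah
        obtain ⟨z, rfl, hz⟩ := hs a ha
        have := hc (f, Sum.inr ⟨z, hah⟩)
        rwa [hr0, hr1, hfγ, hz] at this
      refine ⟨Function.update s h γ, ?_, ?_⟩
      · intro a ha'
        rcases mem_insert.1 ha' with rfl | ha
        · exact ⟨pt f none, hπpt _ _, by simp [hfγ]⟩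
        · obtain ⟨z, hz, hz'⟩ := hs a ha
          refine ⟨cp f z, hz, ?_⟩
          rw [Function.update_of_ne (by rintro rfl; exact hhS ha)]
          exact hz'
      · have hne : ∀ a ∈ S, a ≠ h := by rintro a ha rfl; exact hhS ha
        intro a ha' b hb' hab
        rcases mem_insert.1 ha' with rfl | ha <;> rcases mem_insert.1 hb' with rfl | hb
        · exact absurd hab (H.irrefl)
        · rw [Function.update_self, Function.update_of_ne (hne b hb)]
          exact (key b hb hab.symm).symm
        · rw [Function.update_self, Function.update_of_ne (hne a ha)]
          exact key a ha hab
        · rw [Function.update_of_ne (hne a ha), Function.update_of_ne (hne b hb)]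
          exact hsadj a ha b hb hab

/-- The graph with edges `{e j 0, e j 1}`; a degenerate pair is not an edge. -/
def graphOfEdges (e : J → Fin 2 → Z) : SimpleGraph Z :=
  SimpleGraph.fromRel fun x y => ∃ j, e j 0 = x ∧ e j 1 = y

/-- A cycle of length `t` in the graph consists of `t` edges on only `t` vertices. -/
theorem BergeSparse.le_egirth {e : J → Fin 2 → Z} (he : BergeSparse g e) :
    (g : ℕ∞) ≤ (graphOfEdges e).egirth := by
  classical
  rw [SimpleGraph.le_egirth]
  intro a w hw
  by_contra hlt
  rw [not_le, Nat.cast_lt] at hlt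
  have hex : ∀ d ∈ w.edges.toFinset, ∃ j, s(e j 0, e j 1) = d := by
    intro d hd
    have hd := w.edges_subset_edgeSet (List.mem_toFinset.1 hd)
    induction d with | _ x y
    obtain ⟨-, ⟨j, rfl, rfl⟩ | ⟨j, rfl, rfl⟩⟩ := hd
    · exact ⟨j, rfl⟩
    · exact ⟨j, Sym2.eq_swap⟩
  obtain ⟨J', hJ'⟩ : ∃ J' : Sym2 Z → J, ∀ d ∈ w.edges.toFinset, s(e (J' d) 0, e (J' d) 1) = d := by
    have hE : w.edges.toFinset.Nonempty := by
      rw [← card_pos, List.toFinset_card_of_nodup hw.edges_nodup, SimpleGraph.Walk.length_edges]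
      have := hw.three_le_length
      omega
    have : Nonempty J := ⟨(hex _ hE.choose_spec).choose⟩
    choose! J' hJ' using hex
    exact ⟨J', hJ'⟩
  have hinj : Set.InjOn J' w.edges.toFinset := by
    intro d hd d' hd' h
    rw [← hJ' d hd, ← hJ' d' hd', h]
  have hcE : #w.edges.toFinset = w.length := by
    rw [List.toFinset_card_of_nodup hw.edges_nodup, SimpleGraph.Walk.length_edges]
  have hT : #(w.edges.toFinset.image J') = w.length := by
    rw [card_image_of_injOn hinj, hcE]
  have hpos : 3 ≤ w.length := hw.three_le_length
  have h1 := he.le_card (T := w.edges.toFinset.image J')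
    (card_pos.1 (by omega)) (by omega)
  have h2 : (w.edges.toFinset.image J').biUnion (fun j => univ.image (e j)) ⊆
      w.support.tail.toFinset := by
    intro z hz
    simp only [mem_biUnion, mem_image, mem_univ, true_and, exists_exists_and_eq_and] at hz
    obtain ⟨d, hd, i, rfl⟩ := hz
    have hd' := hJ' d hd
    have hz : e (J' d) i ∈ d := by
      have hi : e (J' d) i ∈ s(e (J' d) 0, e (J' d) 1) := by fin_cases i <;> simp
      rwa [hd'] at hi
    have hsupp := w.mem_support_of_mem_edges (List.mem_toFinset.1 hd) hz
    rw [List.mem_toFinset]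
    rcases w.mem_support_iff.1 hsupp with h | h
    · rw [h]
      exact SimpleGraph.Walk.end_mem_tail_support hw.not_nil
    · exact h
  have h3 : #w.support.tail.toFinset ≤ w.length := by
    refine (List.toFinset_card_le _).trans ?_
    simp
  have h4 := card_le_card h2
  rw [hT, Fintype.card_fin] at h1
  omega

theorem graphOfEdges_adj {e : J → Fin 2 → Z} {x y : Z} : (graphOfEdges e).Adj x y ↔
    x ≠ y ∧ ((∃ j, e j 0 = x ∧ e j 1 = y) ∨ ∃ j, e j 0 = y ∧ e j 1 = x) :=
  SimpleGraph.fromRel_adj _ _ _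

/-- `exists_sparse_lift` for graphs: `π` is a homomorphism, and each vertex `x` has at most one
neighbour of larger rank `ρ` in each fibre of `π`. -/
theorem exists_sparse_lift_graph {VH : Type} [Finite VH] (H : SimpleGraph VH) (C : Type) [Finite C]
    [Nonempty C] (g : ℕ) :
    ∃ (Z : Type) (_ : Finite Z) (G : SimpleGraph Z) (π : Z → VH) (ρ : Z → ℕ),
      (g : ℕ∞) ≤ G.egirth ∧
      (∀ x y, G.Adj x y → H.Adj (π x) (π y) ∧ ρ x ≠ ρ y) ∧
      (∀ x y y', G.Adj x y → G.Adj x y' → ρ x < ρ y → ρ x < ρ y' → π y = π y' → y = y') ∧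
      ∀ c : G.Coloring C, ∃ s : H.Coloring C, ∀ h, ∃ z, π z = h ∧ c z = s h := by
  obtain ⟨n, ⟨φ⟩⟩ := Finite.exists_equiv_fin VH
  let H' : SimpleGraph (Fin n) := H.comap φ.symm
  obtain ⟨Z, J, hZ, -, e, π, -, hadj, huniq, hsp, hcol⟩ :=
    exists_sparse_lift H' C (g + 2) (by omega) univ
  have hlt : ∀ x y, (graphOfEdges e).Adj x y → (π x : ℕ) < π y → ∃ j, e j 0 = x ∧ e j 1 = y := by
    intro x y h hxy
    obtain ⟨-, h | ⟨j, rfl, rfl⟩⟩ := graphOfEdges_adj.1 h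
    · exact h
    · exact absurd hxy (hadj j).2.le.not_gt
  refine ⟨Z, hZ, graphOfEdges e, φ.symm ∘ π, fun z => π z, ?_, ?_, ?_, ?_⟩
  · exact le_trans (by exact_mod_cast (by omega : g ≤ g + 2 + 1)) hsp.le_egirth
  · intro x y h
    obtain ⟨-, ⟨j, rfl, rfl⟩ | ⟨j, rfl, rfl⟩⟩ := graphOfEdges_adj.1 h
    · exact ⟨(hadj j).1, (Fin.lt_def.1 (hadj j).2).ne⟩
    · exact ⟨(hadj j).1.symm, (Fin.lt_def.1 (hadj j).2).ne'⟩
  · intro x y y' h h' hxy hxy' hπ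
    obtain ⟨j, rfl, rfl⟩ := hlt x y h hxy
    obtain ⟨j', hj, rfl⟩ := hlt _ y' h' hxy'
    exact huniq j j' hj.symm (φ.symm.injective hπ)
  · intro c
    obtain ⟨s, hs, hsadj⟩ := hcol c fun j => c.valid <| graphOfEdges_adj.2
      ⟨fun h => (hadj j).2.ne (congrArg π h), Or.inl ⟨j, rfl, rfl⟩⟩
    refine ⟨SimpleGraph.Coloring.mk (fun h => s (φ h)) fun {h h'} hh =>
      hsadj _ (mem_univ _) _ (mem_univ _) (by simpa [H'] using hh), fun h => ?_⟩
    obtain ⟨z, hz, hz'⟩ := hs (φ h) (mem_univ _)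
    exact ⟨z, by simp [hz], hz'⟩

end

/-! ### Partitions and list colouring -/

theorem Nat.Partition.exists_fin_parts {k : ℕ} (l : Nat.Partition k) :
    ∃ (q : ℕ) (κ : Fin q → ℕ), Multiset.map κ univ.val = l.parts :=
  ⟨l.parts.toList.length, l.parts.toList.get, by
    rw [Fin.univ_val_map, List.ofFn_get, Multiset.coe_toList]⟩

/-- If the parts of `l'` can be distributed over the parts of `l` so that each part of `l` receives
at least its own size, then `l` is dominated by `l'`. -/
theorem Nat.Partition.dominated_of_le_sum {k k' q t : ℕ} {l : Nat.Partition k}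
    {l' : Nat.Partition k'} {κ : Fin q → ℕ} (hκ : Multiset.map κ univ.val = l.parts)
    {κ' : Fin t → ℕ} (hκ' : Multiset.map κ' univ.val = l'.parts) (φ : Fin t → Fin q)
    (h : ∀ i, κ i ≤ ∑ j with φ j = i, κ' j) : l.Dominated l' := by
  have hpos : ∀ i, 0 < κ i := fun i =>
    l.parts_pos (hκ ▸ Multiset.mem_map_of_mem κ (mem_univ_val i))
  let ν : Nat.Partition k' :=
    { parts := Multiset.map (fun i => ∑ j with φ j = i, κ' j) univ.val
      parts_pos := by
        intro a ha
        obtain ⟨i, -, rfl⟩ := Multiset.mem_map.1 ha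
        exact (hpos i).trans_le (h i)
      parts_sum := by
        have h1 : ∑ i, ∑ j with φ j = i, κ' j = ∑ j, κ' j := sum_fiberwise _ _ _
        have h2 : ∑ j, κ' j = k' := by
          rw [← l'.parts_sum, ← hκ']; rfl
        exact h1.trans h2 }
  refine ⟨ν, ?_, Multiset.map (fun i => Multiset.map κ' (univ.filter fun j => φ j = i).val) univ.val,
    ?_, ?_⟩
  · rw [← hκ, Multiset.rel_map]
    exact Multiset.rel_refl_of_refl_on fun i _ => h i
  · rw [Multiset.map_map]
    rfl
  · rw [← hκ', ← Multiset.bind, ← Multiset.map_bind]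
    congr 1
    ext j
    rw [Multiset.count_bind]
    change ∑ i, Multiset.count j (univ.filter fun j => φ j = i).val = Multiset.count j univ.val
    have h1 : ∀ i, Multiset.count j (univ.filter fun j => φ j = i).val = if φ j = i then 1 else 0 := by
      intro i
      rw [Multiset.count_eq_of_nodup (nodup _)]
      simp only [mem_val, mem_filter, mem_univ, true_and]
    rw [sum_congr rfl fun i _ => h1 i, Multiset.count_eq_of_nodup (nodup _)]
    simp

theorem Multiset.exists_perm_of_map_univ_eq {α β : Type} [Fintype α] {f g : α → β}
    (h : Multiset.map f univ.val = Multiset.map g univ.val) : ∃ σ : Equiv.Perm α, f = g ∘ σ := by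
  classical
  have hcard : ∀ b, Fintype.card {a // f a = b} = Fintype.card {a // g a = b} := by
    intro b
    have h1 := congrArg (Multiset.count b) h
    simp only [Multiset.count_map, eq_comm (a := b)] at h1
    rw [Fintype.card_subtype, Fintype.card_subtype]
    exact h1
  refine ⟨Equiv.ofFiberEquiv fun b => Fintype.equivOfCardEq (hcard b), ?_⟩
  ext a
  exact (Equiv.ofFiberEquiv_map _ a).symm

namespace SimpleGraph
section
variable {V V' C : Type}

/-- Greedy colouring from lists that are longer than the number of neighbours of larger rank. -/
theorem listColorable_of_card_lt [Finite V] {G : SimpleGraph V} {L : V → Finset C} (ρ : V → ℕ)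
    (hρ : ∀ x y, G.Adj x y → ρ x ≠ ρ y)
    (h : ∀ x, {y | G.Adj x y ∧ ρ x < ρ y}.ncard < #(L x)) : G.ListColorable L := by
  classical
  have key : ∀ (x : V) (f : ∀ y, ρ x < ρ y → C), ∃ c ∈ L x, ∀ y (hy : ρ x < ρ y), G.Adj x y →
      f y hy ≠ c := by
    intro x f
    by_contra! hcon
    have hsub : (L x : Set C) ⊆
        Set.range fun y : {y | G.Adj x y ∧ ρ x < ρ y} => f y.1 y.2.2 := by
      intro c hc
      obtain ⟨y, hy, hxy, rfl⟩ := hcon c hc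
      exact ⟨⟨y, hxy, hy⟩, rfl⟩
    have h1 := Set.ncard_le_ncard hsub (Set.toFinite _)
    have h2 := Finite.card_range_le fun y : {y | G.Adj x y ∧ ρ x < ρ y} => f y.1 y.2.2
    rw [Set.ncard_coe_finset] at h1
    rw [Nat.card_coe_set_eq, Nat.card_coe_set_eq] at h2
    have := h x
    omega
  have wf : WellFounded fun y x : V => ρ x < ρ y := by
    have : IsTrans V fun y x : V => ρ x < ρ y := ⟨fun _ _ _ h1 h2 => lt_trans h2 h1⟩
    have : Std.Irrefl fun y x : V => ρ x < ρ y := ⟨fun _ => lt_irrefl _⟩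
    exact Finite.wellFounded_of_trans_of_irrefl _
  let f : V → C := wf.fix fun x ih => (key x ih).choose
  have hf : ∀ x, f x = (key x fun y _ => f y).choose := fun x => wf.fix_eq _ x
  have hlt : ∀ x y, G.Adj x y → ρ x < ρ y → f x ≠ f y := by
    intro x y hxy hlt
    rw [hf x]
    exact ((key x fun y _ => f y).choose_spec.2 y hlt hxy).symm
  refine ⟨Coloring.mk f fun {x y} hxy => ?_, fun x => ?_⟩
  · rcases lt_or_gt_of_ne (hρ x y hxy) with h1 | h1
    · exact hlt x y hxy h1
    · exact (hlt y x hxy.symm h1).symm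
  · change f x ∈ L x
    rw [hf x]
    exact (key x fun y _ => f y).choose_spec.1

/-- The vertices of `G` fall into classes, one for each `i : Fin q`, such that class `i` induces a
graph in which every vertex has fewer than `κ i` neighbours of larger rank; the rank `ρ` is required to
separate adjacent vertices. -/
def HasDegenerateClasses (G : SimpleGraph V) {q : ℕ} (κ : Fin q → ℕ) : Prop :=
  ∃ (cl : V → Fin q) (ρ : V → ℕ), (∀ x y, G.Adj x y → ρ x ≠ ρ y) ∧
    ∀ x, {y | G.Adj x y ∧ cl y = cl x ∧ ρ x < ρ y}.ncard < κ (cl x)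

/-- Each class is coloured greedily with the colours of its own colour group. -/
theorem HasDegenerateClasses.listColorable [Finite V] {G : SimpleGraph V} {q : ℕ} {κ : Fin q → ℕ}
    (hG : G.HasDegenerateClasses κ) {L : V → Finset C} {D : Fin q → Set C}
    (hD : ∀ i j, i ≠ j → Disjoint (D i) (D j)) (hL : ∀ v i, ((L v : Set C) ∩ D i).ncard = κ i) :
    G.ListColorable L := by
  classical
  obtain ⟨cl, ρ, hρ, hdeg⟩ := hG
  let G' : SimpleGraph V :=
    { Adj := fun x y => G.Adj x y ∧ cl y = cl x
      symm := ⟨fun x y h => ⟨h.1.symm, h.2.symm⟩⟩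
      loopless := ⟨fun x h => G.irrefl h.1⟩ }
  obtain ⟨f, hf⟩ := listColorable_of_card_lt (G := G') (L := fun v => (L v).filter (· ∈ D (cl v))) ρ
    (fun x y h => hρ x y h.1) (fun x => by
      have h1 : #((L x).filter (· ∈ D (cl x))) = κ (cl x) := by
        rw [← hL x (cl x), ← Set.ncard_coe_finset]
        congr 1
        ext c
        simp
      rw [h1]
      simpa only [G', and_assoc] using hdeg x)
  have hf' : ∀ v, f v ∈ L v ∧ f v ∈ D (cl v) := fun v => mem_filter.1 (hf v)
  refine ⟨Coloring.mk f fun {x y} hxy => ?_, fun v => (hf' v).1⟩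
  by_cases hcl : cl y = cl x
  · exact f.valid (show G'.Adj x y from ⟨hxy, hcl⟩)
  · intro h
    exact Set.disjoint_left.1 (hD _ _ hcl) (hf' y).2 (h ▸ (hf' x).2)

theorem HasDegenerateClasses.partitionChoosable [Finite V] {G : SimpleGraph V} {k q : ℕ}
    {l : Nat.Partition k} {κ : Fin q → ℕ} (hκ : Multiset.map κ univ.val = l.parts)
    (hG : G.HasDegenerateClasses κ) : G.PartitionChoosable l := by
  rintro C L ⟨-, q', κ', D, hκ', hD, -, hL⟩
  have hq : q' = q := by simpa using congrArg Multiset.card (hκ'.trans hκ.symm)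
  subst hq
  obtain ⟨σ, rfl⟩ := Multiset.exists_perm_of_map_univ_eq (hκ.trans hκ'.symm)
  exact hG.listColorable (D := D ∘ σ) (fun i j hij => hD _ _ (σ.injective.ne hij))
    fun v i => hL v (σ i)

theorem IsPartitionAssignment.comp {k : ℕ} {l : Nat.Partition k} {L : V → Finset C}
    (h : IsPartitionAssignment l L) (r : V' → V) : IsPartitionAssignment l (L ∘ r) := by
  obtain ⟨hc, q, κ, D, h1, h2, h3, h4⟩ := h
  -- only the colours that still occur may stay in the colour groups
  refine ⟨fun v => hc _, q, κ, fun i => D i ∩ ⋃ v, (L (r v) : Set C), h1,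
    fun i j hij => (h2 i j hij).mono Set.inter_subset_left Set.inter_subset_left, ?_, ?_⟩
  · rw [← Set.iUnion_inter, h3]
    refine Set.inter_eq_right.2 ?_
    exact Set.iUnion_subset fun v => Set.subset_iUnion (fun v => (L v : Set C)) (r v)
  · intro v i
    have h5 : (L (r v) : Set C) ⊆ ⋃ v, (L (r v) : Set C) :=
      Set.subset_iUnion (fun v => (L (r v) : Set C)) v
    rw [← h4 (r v) i]
    congr 1
    ext c
    exact ⟨fun h => ⟨h.1, h.2.1⟩, fun h => ⟨h.1, h.2, h5 h.1⟩⟩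

/-- Lists on a subgraph are extended to the whole graph by repeating lists that occur already. -/
theorem PartitionChoosable.of_isContained {k : ℕ} {l : Nat.Partition k} {G : SimpleGraph V}
    {G' : SimpleGraph V'} (h : G'.PartitionChoosable l) (hG : G ⊑ G') :
    G.PartitionChoosable l := by
  obtain ⟨φ⟩ := hG
  intro C L hL
  cases isEmpty_or_nonempty V
  · exact ⟨Coloring.mk isEmptyElim fun {v} => isEmptyElim v, isEmptyElim⟩
  have hr := Function.leftInverse_invFun φ.injective
  obtain ⟨f, hf⟩ := h C _ (hL.comp (Function.invFun φ.toHom))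
  refine ⟨f.comp φ.toHom, fun v => ?_⟩
  have := hf (φ.toHom v)
  rwa [Function.comp_apply, hr v] at this

end
end SimpleGraph

/-! ### Cycles and joins of cliques -/

namespace SimpleGraph

section
variable {C : Type} {n : ℕ}

theorem cycleGraph_eq_graphOfEdges :
    cycleGraph (n + 3) = graphOfEdges fun (j : Fin (n + 3)) => ![j, j + 1] := by
  ext u v
  rw [cycleGraph_adj, graphOfEdges_adj]
  simp only [Matrix.cons_val_zero, Matrix.cons_val_one, exists_eq_left]
  constructor
  · rintro (h | h)
    · obtain rfl : u = v + 1 := by rw [← h]; abel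
      exact ⟨by simp, Or.inr rfl⟩
    · obtain rfl : v = u + 1 := by rw [← h]; abel
      exact ⟨by simp, Or.inl rfl⟩
  · rintro ⟨-, rfl | rfl⟩
    · right; abel
    · left; abel

theorem _root_.bergeSparse_cycle : BergeSparse (n + 3) fun (j : Fin (n + 3)) => ![j, j + 1] := by
  classical
  refine bergeSparse_iff.2 fun T hT hc => ?_
  have hsub : T ⊂ T.biUnion fun j => univ.image ![j, j + 1] := by
    refine ⟨fun j hj => mem_biUnion.2 ⟨j, hj, mem_image.2 ⟨0, mem_univ _, rfl⟩⟩, fun hsub => ?_⟩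
    -- otherwise `T` is closed under `j ↦ j + 1`, hence everything
    have hstep : ∀ j ∈ T, j + 1 ∈ T := fun j hj =>
      hsub (mem_biUnion.2 ⟨j, hj, mem_image.2 ⟨1, mem_univ _, rfl⟩⟩)
    obtain ⟨a, ha⟩ := hT
    have hall : ∀ b, a + b ∈ T := by
      intro b
      induction b using Fin.induction with
      | zero => simpa using ha
      | succ b ih =>
        have := hstep _ ih
        rwa [add_assoc, Fin.coeSucc_eq_succ] at this
    have huniv : T = univ := by
      refine eq_univ_of_forall fun b => ?_
      have := hall (b - a)
      rwa [add_sub_cancel] at this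
    rw [huniv, card_univ, Fintype.card_fin] at hc
    exact lt_irrefl _ hc
  have := card_lt_card hsub
  rw [Fintype.card_fin]
  omega

theorem le_egirth_cycleGraph : ((n + 3 : ℕ) : ℕ∞) ≤ (cycleGraph (n + 3)).egirth := by
  rw [cycleGraph_eq_graphOfEdges]
  exact bergeSparse_cycle.le_egirth

theorem cycleGraph_listColorable_of_three_le {L : Fin (n + 3) → Finset C} (hL : ∀ v, 3 ≤ #(L v)) :
    (cycleGraph (n + 3)).ListColorable L := by
  refine listColorable_of_card_lt Fin.val (fun x y h => Fin.val_ne_of_ne h.ne) fun x => ?_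
  refine lt_of_lt_of_le ?_ (hL x)
  have hsub : {y | (cycleGraph (n + 3)).Adj x y ∧ x.val < y.val} ⊆ {x - 1, x + 1} := by
    rw [← cycleGraph_neighborSet (n := n + 1)]
    exact fun y hy => hy.1
  have h1 := Set.ncard_le_ncard hsub (Set.toFinite _)
  have h2 := Set.ncard_insert_le (x - 1) {x + 1}
  rw [Set.ncard_singleton] at h2
  omega

/-- Even cycles are `2`-choosable. If two consecutive lists differ, give the first of these vertices
a colour that is missing in the other list; this makes the edge between them irrelevant, and the
remaining path is coloured greedily. -/
theorem cycleGraph_listColorable_of_even (hn : Even (n + 3)) {L : Fin (n + 3) → Finset C}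
    (hL : ∀ v, #(L v) = 2) : (cycleGraph (n + 3)).ListColorable L := by
  classical
  by_cases hconst : ∀ v, L v = L (v + 1)
  · have hall : ∀ v, L v = L 0 := by
      intro v
      induction v using Fin.induction with
      | zero => rfl
      | succ v ih => rw [← Fin.coeSucc_eq_succ, ← hconst, ih]
    obtain ⟨a, b, hab, h0⟩ := card_eq_two.1 (hL 0)
    let f := cycleGraph.bicoloring_of_even (n + 3) hn
    refine ⟨Coloring.mk (fun v => if f v then a else b) fun {u v} huv => ?_, fun v => ?_⟩
    · have hne := f.valid huv
      change (if f u then a else b) ≠ if f v then a else b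
      cases hu : f u <;> cases hv : f v
      · exact absurd (hu.trans hv.symm) hne
      · exact hab.symm
      · exact hab
      · exact absurd (hu.trans hv.symm) hne
    · rw [hall v, h0]
      change (if f v then a else b) ∈ _
      split_ifs <;> simp
  · push Not at hconst
    obtain ⟨v, hv⟩ := hconst
    obtain ⟨a, hav, hav'⟩ : ∃ a ∈ L v, a ∉ L (v + 1) := by
      by_contra! hcon
      exact hv (eq_of_subset_of_card_le hcon (by rw [hL, hL]))
    let G' := (cycleGraph (n + 3)).deleteEdges {s(v, v + 1)}
    let ρ : Fin (n + 3) → ℕ := fun u => (u - (v + 1)).val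
    have hρv : ρ v = n + 2 := by
      have : v - (v + 1) = Fin.last (n + 2) := by
        rw [sub_add_cancel_left, ← Fin.neg_last, neg_neg]
      change (v - (v + 1)).val = _
      rw [this, Fin.val_last]
    have hρ1 : ∀ u, u ≠ v → ρ (u + 1) = ρ u + 1 := by
      intro u hu
      change (u + 1 - (v + 1)).val = (u - (v + 1)).val + 1
      have h1 : u + 1 - (v + 1) = u - (v + 1) + 1 := by abel
      have h2 : u - (v + 1) ≠ Fin.last (n + 2) := by
        intro h
        apply hu
        have : u - (v + 1) = v - (v + 1) := by
          rw [h]; exact (Fin.ext hρv).symm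
        exact sub_left_injective this
      rw [h1, Fin.val_add_one, if_neg h2]
    have hinj : ∀ x y, ρ x = ρ y → x = y := fun x y h => sub_left_injective (Fin.ext h)
    have hle : ∀ u, ρ u ≤ n + 2 := fun u => Nat.lt_succ_iff.1 (u - (v + 1)).isLt
    obtain ⟨f, hf⟩ := listColorable_of_card_lt (G := G')
      (L := fun u => if u = v then {a} else L u) ρ
      (fun x y h hxy => h.ne (hinj x y hxy)) (fun x => by
        have hsub : {y | G'.Adj x y ∧ ρ x < ρ y} ⊆ if x = v then ∅ else {x + 1} := by
          rintro y ⟨hxy, hlt⟩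
          obtain ⟨hadj, hne⟩ := (deleteEdges_adj).1 hxy
          split_ifs with hxv
          · have := hle y
            rw [hxv, hρv] at hlt
            omega
          · rcases cycleGraph_adj.1 hadj with h | h
            · obtain rfl : x = y + 1 := by rw [← h]; abel
              by_cases hyv : y = v
              · subst hyv
                exact absurd (Set.mem_singleton_iff.2 Sym2.eq_swap) hne
              · have := hρ1 y hyv
                omega
            · have : y = x + 1 := by rw [← h]; abel
              exact this
        have h1 := Set.ncard_le_ncard hsub (Set.toFinite _)
        refine h1.trans_lt ?_
        split_ifs with hxv
        · simp
        · simp [hL x])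
    have hfv : f v = a := by simpa using hf v
    have hfL : ∀ u, f u ∈ L u := by
      intro u
      have := hf u
      dsimp only at this
      split_ifs at this with huv
      · rw [huv, hfv]; exact hav
      · exact this
    refine ⟨Coloring.mk f fun {x y} hxy => ?_, hfL⟩
    by_cases he : s(x, y) = s(v, v + 1)
    · have hne : f v ≠ f (v + 1) := fun h => hav' (by rw [← hfv, h]; exact hfL _)
      rcases Sym2.eq_iff.1 he with ⟨rfl, rfl⟩ | ⟨rfl, rfl⟩
      · exact hne
      · exact hne.symm
    · exact f.valid (show G'.Adj x y from deleteEdges_adj.2 ⟨hxy, he⟩)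

end

section
variable {q t : ℕ}

/-- The lists with exactly `κ' j` colours in the `j`-th of `t` colour groups of size `2 * m`. -/
abbrev GroupList (κ' : Fin t → ℕ) (m : ℕ) : Type :=
  {Λ : Finset (Fin t × Fin (2 * m)) // ∀ j, #{c ∈ Λ | c.1 = j} = κ' j}

/-- The graph with vertex classes `i : Fin q`, class `i` being the disjoint union of cliques of size
`κ i`, one for each list `Λ`, and distinct classes being completely joined. A vertex
`⟨i, Λ, a⟩` is meant to have `Λ` as its list. -/
def joinOfCliques (κ : Fin q → ℕ) (κ' : Fin t → ℕ) (m : ℕ) :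
    SimpleGraph (Σ i, GroupList κ' m × Fin (κ i)) where
  Adj x y := x.1 ≠ y.1 ∨ x.2.1 = y.2.1 ∧ x ≠ y
  symm := ⟨fun _ _ h => h.imp Ne.symm fun h => ⟨h.1.symm, h.2.symm⟩⟩
  loopless := ⟨fun _ h => h.elim (fun h => h rfl) fun h => h.2 rfl⟩

/-- Distinct classes use disjoint sets of colours. So each colour group `j` has a class `φ j` such
that any other class leaves at least half of group `j` unused. If class `i` has too few groups
with `φ j = i`, choose a list whose other colours are not used in class `i`: its clique in
class `i` then has more vertices than available colours. -/
theorem joinOfCliques_not_colorable {κ : Fin q → ℕ} {κ' : Fin t → ℕ} {m : ℕ} (hq : 0 < q)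
    (hm : ∀ j, κ' j ≤ m) (h : ∀ φ : Fin t → Fin q, ∃ i, ∑ j with φ j = i, κ' j < κ i)
    (s : (joinOfCliques κ κ' m).Coloring (Fin t × Fin (2 * m))) : ∃ x, s x ∉ x.2.1.1 := by
  classical
  by_contra! hs
  let U : Fin q → Finset (Fin t × Fin (2 * m)) := fun i => univ.filter fun c => ∃ x, x.1 = i ∧ s x = c
  let B : Fin t → Finset (Fin t × Fin (2 * m)) := fun j => univ.filter fun c => c.1 = j
  have hB : ∀ j, #(B j) = 2 * m := by
    intro j
    have : B j = univ.map (Function.Embedding.sectR j (Fin (2 * m))) := by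
      ext ⟨a, b⟩
      simp [B, eq_comm]
    rw [this, card_map, card_univ, Fintype.card_fin]
  have hU : ∀ i i', i ≠ i' → Disjoint (U i) (U i') := by
    intro i i' hi
    rw [Finset.disjoint_left]
    intro c h1 h2
    obtain ⟨x, rfl, hx⟩ := (mem_filter.1 h1).2
    obtain ⟨y, rfl, hy⟩ := (mem_filter.1 h2).2
    exact s.valid (show (joinOfCliques κ κ' m).Adj x y from Or.inl hi) (hx.trans hy.symm)
  let φ : Fin t → Fin q := fun j =>
    if hj : ∃ i, m < #(B j ∩ U i) then hj.choose else ⟨0, hq⟩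
  have hφ : ∀ i j, φ j ≠ i → m ≤ #(B j \ U i) := by
    intro i j hij
    have h1 := card_sdiff_add_card_inter (B j) (U i)
    rw [hB] at h1
    by_cases hj : ∃ i, m < #(B j ∩ U i)
    · have h2 : φ j = hj.choose := dif_pos hj
      have h3 := hj.choose_spec
      rw [← h2] at h3
      have h4 : #(B j ∩ U (φ j)) + #(B j ∩ U i) ≤ #(B j) := by
        rw [← card_union_of_disjoint]
        · exact card_le_card (union_subset inter_subset_left inter_subset_left)
        · exact (hU _ _ hij).mono inter_subset_right inter_subset_right
      rw [hB] at h4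
      omega
    · push Not at hj
      have := hj i
      omega
  obtain ⟨i, hi⟩ := h φ
  have hR : ∀ j, ∃ R ⊆ B j, #R = κ' j ∧ (φ j ≠ i → Disjoint R (U i)) := by
    intro j
    by_cases hj : φ j = i
    · obtain ⟨R, hR, hc⟩ := exists_subset_card_eq (s := B j) (n := κ' j)
        (by rw [hB]; have := hm j; omega)
      exact ⟨R, hR, hc, fun h => absurd hj h⟩
    · obtain ⟨R, hR, hc⟩ := exists_subset_card_eq (s := B j \ U i) (n := κ' j)
        ((hm j).trans (hφ i j hj))
      exact ⟨R, hR.trans sdiff_subset, hc, fun _ => disjoint_of_subset_left hR sdiff_disjoint⟩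
  choose R hRB hRc hRU using hR
  have hRj : ∀ j, ∀ c ∈ R j, c.1 = j := fun j c hc => (mem_filter.1 (hRB j hc)).2
  let Λ : GroupList κ' m := ⟨univ.biUnion R, fun j => by
    rw [← hRc j]
    congr 1
    ext c
    simp only [mem_filter, mem_biUnion, mem_univ, true_and]
    constructor
    · rintro ⟨⟨j', hj'⟩, rfl⟩
      rwa [hRj j' c hj']
    · exact fun hc => ⟨⟨j, hc⟩, hRj j c hc⟩⟩
  have hmaps : ∀ a ∈ (univ : Finset (Fin (κ i))),
      s ⟨i, Λ, a⟩ ∈ (univ.filter fun j => φ j = i).biUnion R := by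
    intro a _
    obtain ⟨j, -, hj⟩ := mem_biUnion.1 (hs ⟨i, Λ, a⟩)
    refine mem_biUnion.2 ⟨j, mem_filter.2 ⟨mem_univ _, ?_⟩, hj⟩
    by_contra hij
    exact Finset.disjoint_left.1 (hRU j hij) hj (mem_filter.2 ⟨mem_univ _, ⟨i, Λ, a⟩, rfl, rfl⟩)
  have hinj : Set.InjOn (fun a => s ⟨i, Λ, a⟩) (univ : Finset (Fin (κ i))) := by
    intro a _ b _ hab
    by_contra hne
    refine s.valid (show (joinOfCliques κ κ' m).Adj ⟨i, Λ, a⟩ ⟨i, Λ, b⟩ from Or.inr ⟨rfl, ?_⟩) hab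
    intro heq
    simp at heq
    exact hne heq
  have h1 := card_le_card_of_injOn _ hmaps hinj
  have h2 : #((univ.filter fun j => φ j = i).biUnion R) ≤ ∑ j with φ j = i, κ' j :=
    card_biUnion_le.trans (sum_le_sum fun j _ => (hRc j).le)
  rw [card_univ, Fintype.card_fin] at h1
  omega

end
end SimpleGraph

/-! ### Separating two partitions, and disjoint unions -/

namespace SimpleGraph

/-- A sparse lift of a join of cliques separates `l`-choosability from `l'`-choosability. -/
theorem exists_choosable_not_choosable {k m : ℕ} (hk : 0 < k) (l : Nat.Partition k) (hm : 0 < m)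
    (l' : Nat.Partition m) (hl : ¬ l.Dominated l') (g : ℕ) :
    ∃ (V : Type) (_ : Finite V) (G : SimpleGraph V), (g : ℕ∞) ≤ G.egirth ∧
      G.PartitionChoosable l ∧ ¬ G.PartitionChoosable l' := by
  classical
  obtain ⟨q, κ, hκ⟩ := l.exists_fin_parts
  obtain ⟨t, κ', hκ'⟩ := l'.exists_fin_parts
  have hsum : ∑ i, κ i = k := by rw [← l.parts_sum, ← hκ]; rfl
  have hsum' : ∑ j, κ' j = m := by rw [← l'.parts_sum, ← hκ']; rfl
  have hq : 0 < q := by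
    rcases Nat.eq_zero_or_pos q with rfl | hq
    · simp at hsum; omega
    · exact hq
  have ht : 0 < t := by
    rcases Nat.eq_zero_or_pos t with rfl | ht
    · simp at hsum'; omega
    · exact ht
  have hκ'm : ∀ j, κ' j ≤ m := fun j => hsum' ▸ single_le_sum (fun _ _ => Nat.zero_le _) (mem_univ j)
  have hφ : ∀ φ : Fin t → Fin q, ∃ i, ∑ j with φ j = i, κ' j < κ i := by
    intro φ
    by_contra! hcon
    exact hl (Nat.Partition.dominated_of_le_sum hκ hκ' φ hcon)
  have : Nonempty (Fin t × Fin (2 * m)) := ⟨⟨0, ht⟩, ⟨0, by omega⟩⟩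
  obtain ⟨Z, hZ, G, π, ρ, hg, hadj, huniq, hcol⟩ :=
    exists_sparse_lift_graph (joinOfCliques κ κ' m) (Fin t × Fin (2 * m)) g
  refine ⟨Z, hZ, G, hg, HasDegenerateClasses.partitionChoosable hκ
    ⟨fun z => (π z).1, ρ, fun x y h => (hadj x y h).2, fun x => ?_⟩, fun hch => ?_⟩
  · -- later neighbours in the class of `x` lie over the other vertices of the clique of `π x`
    have hmaps : ∀ y ∈ {y | G.Adj x y ∧ (π y).1 = (π x).1 ∧ ρ x < ρ y},
        π y ∈ (fun b => (⟨(π x).1, (π x).2.1, b⟩ : Σ i, GroupList κ' m × Fin (κ i))) ''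
          {b | b ≠ (π x).2.2} := by
      rintro y ⟨hxy, hcl, -⟩
      have := (hadj x y hxy).1
      generalize π y = u at this hcl
      generalize π x = v at this hcl
      obtain ⟨i, Λ, b⟩ := u
      obtain ⟨i', Λ', b'⟩ := v
      obtain rfl : i = i' := hcl
      rcases this with h | ⟨h, hne⟩
      · exact absurd rfl h
      · obtain rfl : Λ' = Λ := h
        refine ⟨b, ?_, rfl⟩
        rintro rfl
        exact hne rfl
    have h1 := Set.ncard_le_ncard_of_injOn π hmaps
      (fun y hy y' hy' h => huniq x y y' hy.1 hy'.1 hy.2.2 hy'.2.2 h) (Set.toFinite _)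
    have h2 := Set.ncard_image_le (f := fun b =>
      (⟨(π x).1, (π x).2.1, b⟩ : Σ i, GroupList κ' m × Fin (κ i)))
      (Set.toFinite {b | b ≠ (π x).2.2})
    have h3 : {b | b ≠ (π x).2.2}.ncard < κ (π x).1 := by
      have h4 : {b | b ≠ (π x).2.2} ⊂ Set.univ :=
        Set.ssubset_univ_iff.2 fun h => (h ▸ Set.mem_univ (π x).2.2 : _ ∈ {b | b ≠ (π x).2.2}) rfl
      have h5 := Set.ncard_lt_ncard h4 (Set.toFinite _)
      rwa [Set.ncard_univ, Nat.card_fin] at h5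
    exact (h1.trans h2).trans_lt h3
  · have hasg : IsPartitionAssignment l' fun z => (π z).2.1.1 := by
      refine ⟨fun z => ?_, t, κ', fun j => {c | c.1 = j ∧ ∃ z, c ∈ (π z).2.1.1}, hκ', ?_, ?_, ?_⟩
      · refine Eq.trans ?_ hsum'
        rw [card_eq_sum_card_fiberwise (f := Prod.fst) (t := univ) (by simp)]
        exact sum_congr rfl fun j _ => (π z).2.1.2 j
      · intro i j hij
        exact Set.disjoint_left.2 fun c h h' => hij (h.1.symm.trans h'.1)
      · ext c
        simp
      · intro z j
        rw [← (π z).2.1.2 j, ← Set.ncard_coe_finset]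
        congr 1
        ext c
        simp only [Set.mem_inter_iff, mem_coe, Set.mem_ofPred_eq, mem_filter]
        exact ⟨fun h => ⟨h.1, h.2.1⟩, fun h => ⟨h.1, h.2, z, h.1⟩⟩
    obtain ⟨c, hc⟩ := hch _ _ hasg
    obtain ⟨s, hs⟩ := hcol c
    obtain ⟨x, hx⟩ := joinOfCliques_not_colorable hq hκ'm hφ s
    obtain ⟨z, rfl, hz⟩ := hs x
    exact hx (hz ▸ hc z)

section
variable {I C : Type} {V : I → Type}

/-- The disjoint union of a family of graphs. -/
def disjointUnion (G : ∀ i, SimpleGraph (V i)) : SimpleGraph (Σ i, V i) :=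
  ⨆ i, (G i).map (Function.Embedding.sigmaMk i)

theorem disjointUnion_adj {G : ∀ i, SimpleGraph (V i)} {x y : Σ i, V i} :
    (disjointUnion G).Adj x y ↔ ∃ i a b, (G i).Adj a b ∧ ⟨i, a⟩ = x ∧ ⟨i, b⟩ = y := by
  simp only [disjointUnion, iSup_adj, map_adj]
  rfl

theorem isContained_disjointUnion (G : ∀ i, SimpleGraph (V i)) (i : I) :
    G i ⊑ disjointUnion G :=
  ⟨⟨⟨fun a => ⟨i, a⟩, fun {a b} h => disjointUnion_adj.2 ⟨i, a, b, h, rfl, rfl⟩⟩,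
    sigma_mk_injective⟩⟩

theorem ListColorable.disjointUnion {G : ∀ i, SimpleGraph (V i)} {L : (Σ i, V i) → Finset C}
    (h : ∀ i, (G i).ListColorable fun a => L ⟨i, a⟩) : (disjointUnion G).ListColorable L := by
  choose f hf using h
  refine ⟨Coloring.mk (fun x => f x.1 x.2) fun {x y} hxy => ?_, fun x => hf x.1 x.2⟩
  obtain ⟨i, a, b, hab, rfl, rfl⟩ := disjointUnion_adj.1 hxy
  exact (f i).valid hab

theorem PartitionChoosable.disjointUnion {k : ℕ} {l : Nat.Partition k}
    {G : ∀ i, SimpleGraph (V i)} (h : ∀ i, (G i).PartitionChoosable l) :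
    (disjointUnion G).PartitionChoosable l :=
  fun _ _ hL => ListColorable.disjointUnion fun i => h i _ _ (hL.comp (Sigma.mk i))

theorem le_egirth_disjointUnion {G : ∀ i, SimpleGraph (V i)} {g : ℕ∞}
    (h : ∀ i, g ≤ (G i).egirth) : g ≤ (disjointUnion G).egirth := by
  rw [le_egirth]
  intro x w hw
  have hlen := hw.three_le_length
  obtain ⟨φ⟩ := (cycleGraph_isContained_iff (by omega : 2 < w.length)).2 ⟨x, w, hw, rfl⟩
  -- a cycle is connected, so it lies in one member of the family
  have hconst : ∀ u v, (cycleGraph w.length).Adj u v → (φ u).1 = (φ v).1 := by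
    intro u v huv
    obtain ⟨i, a, b, -, ha, hb⟩ := disjointUnion_adj.1 (φ.toHom.map_adj huv)
    have ha' : i = (φ u).1 := congrArg Sigma.fst ha
    have hb' : i = (φ v).1 := congrArg Sigma.fst hb
    exact ha'.symm.trans hb'
  have hreach : ∀ u v, (φ u).1 = (φ v).1 := by
    intro u v
    obtain ⟨p⟩ := cycleGraph_preconnected u v
    induction p with
    | nil => rfl
    | cons h _ ih => exact (hconst _ _ h).trans ih
  let u₀ : Fin w.length := ⟨0, by omega⟩
  have hex : ∀ u, ∃ a : V (φ u₀).1, φ u = ⟨(φ u₀).1, a⟩ := by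
    intro u
    have := hreach u u₀
    generalize φ u = y at this
    obtain ⟨i, a⟩ := y
    obtain rfl : i = (φ u₀).1 := this
    exact ⟨a, rfl⟩
  choose ψ hψ using hex
  have hcont : cycleGraph w.length ⊑ G (φ u₀).1 := by
    refine ⟨⟨⟨ψ, fun {u v} huv => ?_⟩, fun u v huv => ?_⟩⟩
    · have h1 : (SimpleGraph.disjointUnion G).Adj (φ u) (φ v) := φ.toHom.map_adj huv
      rw [hψ u, hψ v] at h1
      obtain ⟨i, a, b, hab, ha, hb⟩ := disjointUnion_adj.1 h1
      obtain rfl : i = (φ u₀).1 := congrArg Sigma.fst ha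
      rw [sigma_mk_injective ha, sigma_mk_injective hb] at hab
      exact hab
    · refine φ.injective ?_
      change φ u = φ v
      rw [hψ u, hψ v]
      exact congrArg _ huv
  obtain ⟨a, p, hp, hpl⟩ := (cycleGraph_isContained_iff (by omega)).1 hcont
  rw [← hpl]
  exact (h _).trans (egirth_le_length hp)

end

theorem cycleGraph_partitionChoosable {k n : ℕ} (l : Nat.Partition k)
    (h : 3 ≤ k ∨ (k = 2 ∧ Even (n + 3))) : (cycleGraph (n + 3)).PartitionChoosable l := by
  intro C L hL
  rcases h with h | ⟨rfl, hn⟩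
  · exact cycleGraph_listColorable_of_three_le fun v => h.trans_eq (hL.1 v).symm
  · exact cycleGraph_listColorable_of_even hn hL.1

end SimpleGraph

open SimpleGraph in
theorem theorem3 {k : ℕ} (hk : 0 < k) (l : Nat.Partition k)
    {p : ℕ} {m : Fin p → ℕ} (hm : ∀ i, 0 < m i) (l' : ∀ i, Nat.Partition (m i))
    (hl : ∀ i, ¬ l.Dominated (l' i)) (g : ℕ) (hg : 0 < g) :
    ∃ (n : ℕ) (G : SimpleGraph (Fin n)),
      (g : ℕ∞) ≤ G.egirth ∧
      (3 ≤ g → (3 ≤ k ∨ (k = 2 ∧ Even g)) → G.egirth = (g : ℕ∞)) ∧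
      G.PartitionChoosable l ∧
      ∀ i, ¬ G.PartitionChoosable (l' i) := by
  -- the component `none` yields a cycle of length `g`, the component `some i` prevents choosability
  -- for `l' i`
  have hcomp : ∀ o : Option (Fin p), ∃ (V : Type) (_ : Finite V) (G : SimpleGraph V),
      (g : ℕ∞) ≤ G.egirth ∧ G.PartitionChoosable l ∧
      (∀ i, o = some i → ¬ G.PartitionChoosable (l' i)) ∧
      (o = none → 3 ≤ g → (3 ≤ k ∨ (k = 2 ∧ Even g)) → cycleGraph g ⊑ G) := by
    rintro (_ | i)
    · by_cases h : 3 ≤ g ∧ (3 ≤ k ∨ (k = 2 ∧ Even g))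
      · obtain ⟨n, rfl⟩ : ∃ n, g = n + 3 := ⟨g - 3, by omega⟩
        exact ⟨Fin (n + 3), inferInstance, cycleGraph (n + 3), le_egirth_cycleGraph,
          cycleGraph_partitionChoosable l h.2, fun _ hi => (Option.some_ne_none _ hi.symm).elim,
          fun _ _ _ => IsContained.rfl⟩
      · refine ⟨Empty, inferInstance, ⊥, by simp, fun C L _ => ?_,
          fun _ hi => (Option.some_ne_none _ hi.symm).elim, fun _ h1 h2 => absurd ⟨h1, h2⟩ h⟩
        exact ⟨Coloring.mk isEmptyElim fun {v} => v.elim, isEmptyElim⟩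
    · obtain ⟨V, hV, G, h1, h2, h3⟩ := exists_choosable_not_choosable hk l (hm i) (l' i) (hl i) g
      refine ⟨V, hV, G, h1, h2, ?_, fun h => (Option.some_ne_none _ h).elim⟩
      rintro _ ⟨⟩
      exact h3
  choose V hV G hG1 hG2 hG3 hG4 using hcomp
  obtain ⟨n, ⟨e⟩⟩ := Finite.exists_equiv_fin (Σ o, V o)
  let iso : disjointUnion G ≃g (disjointUnion G).map e.toEmbedding := SimpleGraph.Iso.map e _
  have hle : (g : ℕ∞) ≤ ((disjointUnion G).map e.toEmbedding).egirth :=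
    (le_egirth_disjointUnion hG1).trans_eq iso.egirth_eq
  refine ⟨n, (disjointUnion G).map e.toEmbedding, hle, fun h3 hcase => le_antisymm ?_ hle,
    (PartitionChoosable.disjointUnion hG2).of_isContained iso.symm.isContained, fun i hi => ?_⟩
  · obtain ⟨a, w, hw, hlen⟩ := (cycleGraph_isContained_iff (by omega)).1
      (((hG4 none rfl h3 hcase).trans (isContained_disjointUnion G none)).trans iso.isContained)
    rw [← hlen]
    exact egirth_le_length hw
  · exact hG3 (some i) i rfl (hi.of_isContained
      ((isContained_disjointUnion G (some i)).trans iso.isContained))
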